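/- Let $T:\mathbb Z_2\to\mathbb Z_2$ be the $3x+1$ map, $T(x)=(3x+1)/2$ for $x$ odd and $T(x)=x/2$ for $x$ even, and let $Q:\mathbb Z_2\to\mathbb Z_2$ be defined by $Q(x)=\sum_{k\ge 0}s_k2^k$, where $s_k\in\{0,1\}$ and $s_k\equiv T^k(x)\pmod 2$. Let $Q_m$ denote the map induced by $Q$ on $\mathbb Z/2^m\mathbb Z$, and let $\mu$ be the Haar measure on $\mathbb Z_2$ with $\mu(\mathbb Z_2)=1$. A cycle $C$ of $Q_m$ of length $2^k$ ($k\le m$) has an *ever-doubling period* if for all $n\ge m$ the elements of $C$ (represented by integers in $[0,2^m)$) all lie in a single cycle of $Q_n$ of length $2^{n-m+k}$. Let $\omega(C)$ denote the $\omega$-limit set of $C$ in $\mathbb Z_2$ under iteration of $Q$. Call a closed set $A\subseteq\mathbb Z_2$ with $\mu(A)>0$ and $Q^{-1}(A)=A$ an *ergodic set* if $Q$ is ergodic on $A$ with respect to the restriction of $\mu$ to $A$. Each of the following is a cycle $C$ of $Q_m$ of length $2^k$ having an ever-doubling period, $\omega(C)$ is an ergodic set, and it has the indicated measure: - $m=5$,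 $k=1$, $C=(5,17)$, $\mu(\omega(C))=2^{-4}$; - $m=6$, $k=2$, $C=(9,29,25,13)$, $\mu(\omega(C))=2^{-4}$; - $m=6$, $k=2$, $C=(41,61,57,45)$, $\mu(\omega(C))=2^{-4}$; - $m=8$, $k=2$, $C=(27,251,219,59)$, $\mu(\omega(C))=2^{-6}$; - $m=8$, $k=2$, $C=(91,187,155,123)$, $\mu(\omega(C))=2^{-6}$. Moreover, in each case $\omega(C)=\bigcup_{c\in C}\{x\in\mathbb Z_2:|x-c|_2\le 2^{-m}\}$, and this set is also the $\omega$-limit set of each one of its points. Finally, up to sets of measure zero, there is no other odd ergodic set of measure at least $2^{-6}$: every ergodic set $A$ consisting of odd 2-adic integers with $\mu(A)\ge 2^{-6}$ coincides, up to a $\mu$-null set, with one of these five sets $\omega(C)$. -/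

import Mathlib

open MeasureTheory Filter
open scoped ENNReal

namespace CollatzErgodic

noncomputable section

/-- Half of an even 2-adic integer (junk value `0` on odd ones). -/
def half (x : ℤ_[2]) : ℤ_[2] :=
  open Classical in if h : (2 : ℤ_[2]) ∣ x then h.choose else 0

theorem two_mul_half {x : ℤ_[2]} (h : (2 : ℤ_[2]) ∣ x) : 2 * half x = x := by
  rw [half, dif_pos h]
  exact h.choose_spec.symm

/-- The `3x+1` map on the 2-adic integers. -/
def T (x : ℤ_[2]) : ℤ_[2] :=
  open Classical in if (2 : ℤ_[2]) ∣ x then half x else half (3 * x + 1)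

theorem two_mul_T_of_even {x : ℤ_[2]} (h : (2 : ℤ_[2]) ∣ x) : 2 * T x = x := by
  rw [T, if_pos h, two_mul_half h]

theorem two_mul_T_of_odd {x : ℤ_[2]} (h : ¬ (2 : ℤ_[2]) ∣ x) : 2 * T x = 3 * x + 1 := by
  have h2 : (2 : ℤ_[2]) ∣ x - 1 := by
    have key : ∀ y : ℤ_[2], (2 : ℤ_[2]) ∣ y ↔ PadicInt.toZMod y = 0 := by
      intro y
      rw [← RingHom.mem_ker, PadicInt.ker_toZMod, PadicInt.maximalIdeal_eq_span_p,
        Ideal.mem_span_singleton]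
      norm_num
    rw [key] at h ⊢
    rw [map_sub, map_one]
    generalize PadicInt.toZMod x = z at h
    revert z
    decide
  rw [T, if_neg h, two_mul_half]
  have e : 3 * x + 1 = 3 * (x - 1) + 2 * 2 := by ring
  rw [e]
  exact dvd_add (Dvd.dvd.mul_left h2 3) (dvd_mul_right 2 2)

/-- The `k`-th term, `0` or `1`, of the parity sequence of `x`. -/
def parity (x : ℤ_[2]) (k : ℕ) : ℕ :=
  open Classical in if (2 : ℤ_[2]) ∣ T^[k] x then 0 else 1

/-- The map `Q`, encoding the parity sequence of `x` as a 2-adic integer. -/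
def Q (x : ℤ_[2]) : ℤ_[2] := ∑' k : ℕ, (parity x k : ℤ_[2]) * 2 ^ k

theorem summable_Q (x : ℤ_[2]) : Summable fun k : ℕ => (parity x k : ℤ_[2]) * 2 ^ k := by
  refine Summable.of_norm_bounded (g := fun k : ℕ => ((2 : ℝ)⁻¹) ^ k)
    (summable_geometric_of_lt_one (by norm_num) (by norm_num)) fun k => ?_
  have h2 : ‖(2 : ℤ_[2])‖ = (2 : ℝ)⁻¹ := by
    simpa using PadicInt.norm_p (p := 2)
  rw [norm_mul, norm_pow, h2]
  exact mul_le_of_le_one_left (by positivity) (PadicInt.norm_le_one _)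

/-- The map `Q_m` induced by `Q` on `ℤ/2^m`. -/
def Qmod (m : ℕ) (c : ZMod (2 ^ m)) : ZMod (2 ^ m) :=
  PadicInt.toZModPow m (Q (c.val : ℤ_[2]))

/-- `C = (c₁, …, c_l)` is a cycle of `Q_m`: the `c_i` are distinct, and `Q_m` sends each of them
to the next one, and the last one to `c₁`. -/
def IsCycle (m : ℕ) (C : List (ZMod (2 ^ m))) : Prop :=
  C ≠ [] ∧ C.Nodup ∧ C.map (Qmod m) = C.rotate 1

/-- `C` is a cycle of `Q_m` of length `2^k` with an ever-doubling period: for all `n ≥ m`, the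
elements of `C` (as integers in `[0, 2^m)`) all lie in one cycle of `Q_n` of length
`2^(n-m+k)`. -/
def EverDoubling (m k : ℕ) (C : List (ZMod (2 ^ m))) : Prop :=
  k ≤ m ∧ IsCycle m C ∧ C.length = 2 ^ k ∧
    ∀ n : ℕ, m ≤ n → ∃ D : List (ZMod (2 ^ n)),
      IsCycle n D ∧ D.length = 2 ^ (n - m + k) ∧ ∀ c ∈ C, (c.val : ZMod (2 ^ n)) ∈ D

instance : MeasurableSpace ℤ_[2] := borel ℤ_[2]

instance : BorelSpace ℤ_[2] := ⟨rfl⟩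

/-- The Haar measure on `ℤ₂` of total mass `1`. -/
def haar2 : Measure ℤ_[2] := Measure.addHaarMeasure ⊤

theorem haar2_univ : haar2 Set.univ = 1 := by
  have h := Measure.addHaarMeasure_self (K₀ := (⊤ : TopologicalSpace.PositiveCompacts ℤ_[2]))
  simpa [haar2] using h

/-- The ω-limit set, under iteration of `Q`, of a set of 2-adic integers. -/
def omegaQ (S : Set ℤ_[2]) : Set ℤ_[2] :=
  omegaLimit atTop (fun (n : ℕ) (x : ℤ_[2]) => Q^[n] x) S

/-- The ω-limit set of a cycle `C` of `Q_m`, whose elements are seen as integers in `[0, 2^m)`. -/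
def omegaCycle (m : ℕ) (C : List (ZMod (2 ^ m))) : Set ℤ_[2] :=
  omegaQ {x | ∃ c ∈ C, x = (c.val : ℤ_[2])}

/-- The union of the balls `B(c, 2^(-m))` over the elements `c` of `C`. -/
def ballUnion (m : ℕ) (C : List (ZMod (2 ^ m))) : Set ℤ_[2] :=
  ⋃ c ∈ C, Metric.closedBall (c.val : ℤ_[2]) ((2 : ℝ) ^ (-(m : ℤ)))

/-- Ergodic sets: closed sets of positive measure, invariant under the bijection `Q`, on which `Q`
is ergodic for the (restricted) Haar measure. -/
def IsErgodicSet (A : Set ℤ_[2]) : Prop :=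
  IsClosed A ∧ Q ⁻¹' A = A ∧ 0 < haar2 A ∧ Ergodic Q (haar2.restrict A)

/-- A line `m | k | C | 2^(-e)` of the table of cycles. -/
structure Row where
  m : ℕ
  k : ℕ
  C : List (ZMod (2 ^ m))
  e : ℕ

/-- The table of odd cycles. -/
def table : List Row :=
  [ ⟨5, 1, [5, 17], 4⟩,
    ⟨6, 2, [9, 29, 25, 13], 4⟩,
    ⟨6, 2, [41, 61, 57, 45], 4⟩,
    ⟨8, 2, [27, 251, 219, 59], 6⟩,
    ⟨8, 2, [91, 187, 155, 123], 6⟩ ]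

end

end CollatzErgodic

namespace CollatzErgodic

/-! `Q` is an isometry with a computable derivative: changing `x` by `2 ^ m * y` changes `Q x` by `2
^ m * 3 ^ s * y` modulo `2 ^ (m + 2)`, where `s` counts the odd terms among the first `m` iterates
of `T` (`dvd_Q_add`). Suppose `N` is even, `Q^[N] x` lies at distance exactly `2 ^ (-n)` from `x`,
and the counts `s` along these `N` steps have even sum. The multiplier is then a power of 9, hence 1
modulo 4, so two rounds move `x` by exactly distance `2 ^ (-(n + 1))`, and the parity condition is
inherited (`EvenReturn.succ`). A finite check at level `m` therefore forces the period to double at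
every later level.

Consequently each orbit over the cycle is dense in its union of balls, which gives the ω-limit sets.
At each level `Q` permutes the residue classes over the cycle transitively, so an invariant measure
there is determined by its mass (`measure_proportional`), and ergodicity follows.

For completeness, every odd residue modulo `2 ^ 10` either lies over the table or is fixed by eight
steps of the induced map. An ergodic set charging a residue of the second kind has measure at most
`8 / 2 ^ 10`, which is less than `2 ^ (-6)`. -/

/-! ### Parity sequences and the recursion for `Q`. -/

theorem two_dvd_or_two_dvd_sub_one (x : ℤ_[2]) : (2 : ℤ_[2]) ∣ x ∨ (2 : ℤ_[2]) ∣ x - 1 := by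
  by_cases h : (2 : ℤ_[2]) ∣ x
  · exact Or.inl h
  · refine Or.inr ⟨T x - x - 1, ?_⟩
    linear_combination -two_mul_T_of_odd h

theorem not_two_dvd_one : ¬ (2 : ℤ_[2]) ∣ 1 := by
  have h : Prime (2 : ℤ_[2]) := by simpa using PadicInt.prime_p (p := 2)
  exact fun h' => h.not_isUnit (isUnit_of_dvd_one h')

theorem prime_two : Prime (2 : ℤ_[2]) := by simpa using PadicInt.prime_p (p := 2)

theorem parity_le_one (x : ℤ_[2]) (k : ℕ) : parity x k = 0 ∨ parity x k = 1 := by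
  unfold parity; split_ifs <;> simp

theorem two_dvd_sub_parity (x : ℤ_[2]) (k : ℕ) : (2 : ℤ_[2]) ∣ T^[k] x - parity x k := by
  unfold parity
  split_ifs with h
  · simpa using h
  · simpa using (two_dvd_or_two_dvd_sub_one _).resolve_left h

theorem parity_succ (x : ℤ_[2]) (k : ℕ) : parity x (k + 1) = parity (T x) k := rfl

theorem parity_eq_iff {x y : ℤ_[2]} {k l : ℕ} :
    parity x k = parity y l ↔ (2 : ℤ_[2]) ∣ T^[k] x - T^[l] y := by
  have hx := two_dvd_sub_parity x k
  have hy := two_dvd_sub_parity y l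
  have key : (2 : ℤ_[2]) ∣ T^[k] x - T^[l] y ↔ (2 : ℤ_[2]) ∣ (parity x k : ℤ_[2]) - parity y l := by
    rw [show T^[k] x - T^[l] y = ((T^[k] x - parity x k) - (T^[l] y - parity y l)) +
      ((parity x k : ℤ_[2]) - parity y l) by ring, dvd_add_right (dvd_sub hx hy)]
  rw [key]
  rcases parity_le_one x k with h | h <;> rcases parity_le_one y l with h' | h' <;>
    simp [h, h', not_two_dvd_one]

theorem two_mul_T (x : ℤ_[2]) : 2 * T x = 3 ^ parity x 0 * x + parity x 0 := by
  unfold parity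
  split_ifs with h
  · simpa using two_mul_T_of_even h
  · simpa using two_mul_T_of_odd h

/-- Peeling off the leading digit shifts the parity sequence; the inductions on the number of digits
rest on this recursion. -/
theorem Q_eq (x : ℤ_[2]) : Q x = parity x 0 + 2 * Q (T x) := by
  rw [Q, (summable_Q x).tsum_eq_zero_add, Q, ← (summable_Q (T x)).tsum_mul_left]
  simp only [parity_succ, pow_zero, mul_one]
  congr 1
  exact tsum_congr fun k => by ring

/-! ### Perturbations of `T` and `Q`; the isometry property. -/

/-- The number of odd terms among the first `m` terms of the trajectory of `x`. -/
noncomputable def oddCount (m : ℕ) (x : ℤ_[2]) : ℕ := ∑ k ∈ Finset.range m, parity x k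

theorem oddCount_succ' (m : ℕ) (x : ℤ_[2]) :
    oddCount (m + 1) x = parity x 0 + oddCount m (T x) := by
  rw [oddCount, Finset.sum_range_succ', add_comm]; rfl

theorem parity_zero_add (x y : ℤ_[2]) : parity (x + 2 * y) 0 = parity x 0 :=
  parity_eq_iff.2 ⟨y, by simp⟩

theorem T_add (x y : ℤ_[2]) : T (x + 2 * y) = T x + 3 ^ parity x 0 * y := by
  have h := two_mul_T (x + 2 * y)
  rw [parity_zero_add] at h
  refine mul_left_cancel₀ (prime_two.ne_zero) ?_
  linear_combination h - two_mul_T x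

/-- Every step halves the perturbation, and an odd step also triples it. -/
theorem T_iterate_add (m : ℕ) (x y : ℤ_[2]) :
    T^[m] (x + 2 ^ m * y) = T^[m] x + 3 ^ oddCount m x * y := by
  induction m generalizing x y with
  | zero => simp [oddCount]
  | succ m ih =>
    rw [Function.iterate_succ_apply, Function.iterate_succ_apply, oddCount_succ',
      show x + 2 ^ (m + 1) * y = x + 2 * (2 ^ m * y) by ring, T_add,
      show T x + 3 ^ parity x 0 * (2 ^ m * y) = T x + 2 ^ m * (3 ^ parity x 0 * y) by ring, ih]
    ring

theorem parity_add (m : ℕ) (x y : ℤ_[2]) {k : ℕ} (hk : k < m) :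
    parity (x + 2 ^ m * y) k = parity x k := by
  obtain ⟨d, rfl⟩ := Nat.exists_eq_add_of_lt hk
  rw [parity_eq_iff, show x + 2 ^ (k + d + 1) * y = x + 2 ^ k * (2 * (2 ^ d * y)) by ring,
    T_iterate_add]
  exact ⟨3 ^ oddCount k x * (2 ^ d * y), by ring⟩

theorem oddCount_add (m : ℕ) (x y : ℤ_[2]) : oddCount m (x + 2 ^ m * y) = oddCount m x :=
  Finset.sum_congr rfl fun _ hk => parity_add m x y (Finset.mem_range.1 hk)

theorem odd_three_pow (n : ℕ) : ¬ (2 : ℤ_[2]) ∣ 3 ^ n := fun h =>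
  not_two_dvd_one <| by
    have h3 := prime_two.dvd_of_dvd_pow h
    have := h3.sub (dvd_refl (2 : ℤ_[2]))
    norm_num at this
    exact absurd this not_two_dvd_one

/-- `Q` is the identity modulo `4`. -/
theorem four_dvd_Q_sub (x : ℤ_[2]) : (4 : ℤ_[2]) ∣ Q x - x := by
  have hT := two_mul_T x
  have h1 : Q x = parity x 0 + 2 * parity (T x) 0 + 4 * Q (T (T x)) := by
    rw [Q_eq x, Q_eq (T x)]; ring
  obtain ⟨z, hz⟩ := two_dvd_sub_parity (T x) 0
  simp only [Function.iterate_zero, id] at hz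
  rcases parity_le_one x 0 with h | h <;> rw [h] at h1 hT <;> push_cast at h1 hT
  · exact ⟨Q (T (T x)) - z, by linear_combination h1 - 2 * hz + hT⟩
  · obtain ⟨w, hw⟩ := two_dvd_sub_parity x 0
    simp only [Function.iterate_zero, id, h] at hw
    push_cast at hw
    exact ⟨Q (T (T x)) - z + w + 1, by linear_combination h1 - 2 * hz + hT + 2 * hw⟩

/-- First-order expansion of `Q` with an error of `2 ^ (m + 2)`. -/
theorem dvd_Q_add (m : ℕ) (x y : ℤ_[2]) :
    (2 : ℤ_[2]) ^ (m + 2) ∣ Q (x + 2 ^ m * y) - (Q x + 2 ^ m * 3 ^ oddCount m x * y) := by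
  induction m generalizing x y with
  -- The two extra digits of precision come from `Q` being the identity modulo 4; each inductive
  -- step gains a factor 2.
  | zero =>
    have := (four_dvd_Q_sub (x + y)).sub (four_dvd_Q_sub x)
    norm_num [oddCount]
    convert this using 1; ring
  | succ m ih =>
    rw [Q_eq, Q_eq x, show x + 2 ^ (m + 1) * y = x + 2 * (2 ^ m * y) by ring, parity_zero_add,
      T_add, show T x + 3 ^ parity x 0 * (2 ^ m * y) = T x + 2 ^ m * (3 ^ parity x 0 * y) by ring,
      oddCount_succ']
    obtain ⟨z, hz⟩ := ih (T x) (3 ^ parity x 0 * y)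
    exact ⟨z, by linear_combination 2 * hz⟩

/-- The multiplier in `dvd_Q_add` is a power of 3, hence odd, so `Q` preserves the 2-adic distance.
-/
theorem dvd_Q_sub_iff (n : ℕ) (x y : ℤ_[2]) :
    (2 : ℤ_[2]) ^ n ∣ Q x - Q y ↔ (2 : ℤ_[2]) ^ n ∣ x - y := by
  constructor
  · intro h
    induction n with
    | zero => simp
    | succ n ih =>
      obtain ⟨z, hz⟩ := ih ((pow_dvd_pow _ n.le_succ).trans h)
      obtain rfl : x = y + 2 ^ n * z := by linear_combination hz
      obtain ⟨v, hv⟩ := dvd_Q_add n y z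
      obtain ⟨w, hw⟩ := h
      have h2 : (2 : ℤ_[2]) ∣ 3 ^ oddCount n y * z := ⟨w - 2 * v, by
        refine mul_left_cancel₀ (pow_ne_zero n prime_two.ne_zero) ?_
        linear_combination hw - hv⟩
      obtain ⟨t, rfl⟩ := (prime_two.dvd_or_dvd h2).resolve_left (odd_three_pow _)
      exact ⟨t, by ring⟩
  · rintro ⟨z, hz⟩
    obtain rfl : x = y + 2 ^ n * z := by linear_combination hz
    obtain ⟨v, hv⟩ := dvd_Q_add n y z
    exact ⟨3 ^ oddCount n y * z + 4 * v, by linear_combination hv⟩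

theorem dvd_Q_iterate_sub_iff (n i : ℕ) (x y : ℤ_[2]) :
    (2 : ℤ_[2]) ^ n ∣ Q^[i] x - Q^[i] y ↔ (2 : ℤ_[2]) ^ n ∣ x - y := by
  induction i with
  | zero => rfl
  | succ i ih => rw [Function.iterate_succ_apply', Function.iterate_succ_apply', dvd_Q_sub_iff, ih]

theorem dvd_Q_iterate_add (m N : ℕ) (x y : ℤ_[2]) :
    (2 : ℤ_[2]) ^ (m + 2) ∣ Q^[N] (x + 2 ^ m * y) -
      (Q^[N] x + 2 ^ m * 3 ^ (∑ i ∈ Finset.range N, oddCount m (Q^[i] x)) * y) := by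
  induction N with
  | zero => simp
  | succ N ih =>
    rw [Function.iterate_succ_apply', Function.iterate_succ_apply', Finset.sum_range_succ]
    set S := ∑ i ∈ Finset.range N, oddCount m (Q^[i] x)
    obtain ⟨w, hw⟩ := (dvd_Q_sub_iff _ _ _).2 ih
    obtain ⟨v, hv⟩ := dvd_Q_add m (Q^[N] x) (3 ^ S * y)
    rw [show Q^[N] x + 2 ^ m * (3 ^ S * y) = Q^[N] x + 2 ^ m * 3 ^ S * y by ring] at hv
    exact ⟨w + v, by linear_combination hw + hv⟩

/-! ### The period-doubling criterion. -/

/-- `x` returns after `N` steps at distance exactly `2 ^ (-n)`, and its trajectory of length `N`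
has an even number of binary digits `1` in the first `n` places. -/
def EvenReturn (n N : ℕ) (x : ℤ_[2]) : Prop :=
  (∃ u, ¬ (2 : ℤ_[2]) ∣ u ∧ Q^[N] x = x + 2 ^ n * u) ∧
    Even (∑ i ∈ Finset.range N, oddCount n (Q^[i] x))

/-- The second round of `N` steps repeats the displacement of the first up to a factor 1 modulo 4,
so the two add up to `2 ^ (n + 1)` times an odd number. Evenness of `N` is what preserves the parity
condition. -/
theorem EvenReturn.succ {n N : ℕ} {x : ℤ_[2]} (hN : Even N) (h : EvenReturn n N x) :
    EvenReturn (n + 1) (N + N) x := by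
  obtain ⟨⟨u, hu, hx⟩, S', hS⟩ := h
  have hshift : ∀ i, ∃ w, ¬ (2 : ℤ_[2]) ∣ w ∧ Q^[N + i] x = Q^[i] x + 2 ^ n * w := by
    intro i
    rw [add_comm, Function.iterate_add_apply, hx]
    obtain ⟨v, hv⟩ := dvd_Q_iterate_add n i x u
    refine ⟨3 ^ (∑ i ∈ Finset.range i, oddCount n (Q^[i] x)) * u + 4 * v, ?_,
      by linear_combination hv⟩
    · intro h
      have h' := (Dvd.dvd.mul_right (⟨2, by norm_num⟩ : (2 : ℤ_[2]) ∣ 4) v)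
      rcases prime_two.dvd_or_dvd ((dvd_add_left h').1 h) with h | h
      · exact odd_three_pow _ h
      · exact hu h
  refine ⟨?_, ?_⟩
  · obtain ⟨v, hv⟩ := dvd_Q_iterate_add n N x u
    -- The even exponent is used here: `u + 9 ^ S' * u` is `2 * u` modulo 4.
    obtain ⟨w, hw⟩ : (4 : ℤ_[2]) ∣ 9 ^ S' - 1 := by
      exact (show (4 : ℤ_[2]) ∣ 9 - 1 from ⟨2, by norm_num⟩).trans
        (by simpa using sub_dvd_pow_sub_pow (9 : ℤ_[2]) 1 S')
    refine ⟨u + 2 * (w * u + v), ?_, ?_⟩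
    · intro h
      exact hu ((dvd_add_left (dvd_mul_right _ _)).1 h)
    · rw [Function.iterate_add_apply]
      have h9 : (3 : ℤ_[2]) ^ (S' + S') = 9 ^ S' := by rw [← two_mul, pow_mul]; norm_num
      rw [hS, h9] at hv
      rw [← hx] at hv
      linear_combination hv + hx + 2 ^ n * u * hw
  · have hsum : ∀ y, oddCount (n + 1) y = oddCount n y + parity y n := fun y =>
      Finset.sum_range_succ _ _
    -- The points at times `i` and `N + i` differ by exactly `2 ^ n` times an odd number, so their
    -- parity sequences agree before place `n` and differ there. Summed over `i`, this gives twice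
    -- the old sum plus `N`.
    have hterm : ∀ i, oddCount (n + 1) (Q^[i] x) + oddCount (n + 1) (Q^[N + i] x) =
        2 * oddCount n (Q^[i] x) + 1 := by
      intro i
      obtain ⟨w, hw, hi⟩ := hshift i
      rw [hi, hsum, hsum, oddCount_add]
      have hne : parity (Q^[i] x + 2 ^ n * w) n ≠ parity (Q^[i] x) n := by
        rw [Ne, parity_eq_iff, T_iterate_add, add_sub_cancel_left]
        exact fun h => (prime_two.dvd_or_dvd h).elim (odd_three_pow _) hw
      rcases parity_le_one (Q^[i] x + 2 ^ n * w) n with h | h <;>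
        rcases parity_le_one (Q^[i] x) n with h' | h' <;> omega
    rw [Finset.sum_range_add, ← Finset.sum_add_distrib, Finset.sum_congr rfl fun i _ => hterm i,
      Finset.sum_add_distrib]
    simpa [← Finset.mul_sum, hS, parity_simps] using hN

theorem EvenReturn.add {m k : ℕ} {x : ℤ_[2]} (hk : k ≠ 0) (h : EvenReturn m (2 ^ k) x) (d : ℕ) :
    EvenReturn (m + d) (2 ^ (k + d)) x := by
  induction d with
  | zero => exact h
  | succ d ih =>
    have := ih.succ ((Nat.even_pow.2 ⟨even_two, by omega⟩))
    rwa [← two_mul, ← pow_succ'] at this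

/-! ### Computing digits of `Q` on natural numbers. -/

/-- The `3x+1` map on the natural numbers. -/
def natT (n : ℕ) : ℕ := if n % 2 = 0 then n / 2 else (3 * n + 1) / 2

/-- The first `m` binary digits of `Q n`, for a natural number `n`. -/
def natQ : ℕ → ℕ → ℕ
  | 0, _ => 0
  | m + 1, n => n % 2 + 2 * natQ m (natT n)

/-- The number of odd terms among the first `m` terms of the trajectory of `n`. -/
def natOddCount : ℕ → ℕ → ℕ
  | 0, _ => 0
  | m + 1, n => n % 2 + natOddCount m (natT n)

theorem two_dvd_natCast_iff (n : ℕ) : (2 : ℤ_[2]) ∣ n ↔ n % 2 = 0 := by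
  rw [← Nat.dvd_iff_mod_eq_zero]
  constructor
  · intro h
    rcases Nat.even_or_odd' n with ⟨k, rfl | rfl⟩
    · exact dvd_mul_right _ _
    · push_cast at h
      exact absurd ((dvd_add_right (dvd_mul_right _ _)).1 h) not_two_dvd_one
  · rintro ⟨k, rfl⟩
    exact ⟨k, by push_cast; rfl⟩

theorem parity_natCast_zero (n : ℕ) : parity n 0 = n % 2 := by
  unfold parity
  simp only [Function.iterate_zero, id, two_dvd_natCast_iff]
  split_ifs <;> omega

theorem T_natCast (n : ℕ) : T n = natT n := by
  refine mul_left_cancel₀ prime_two.ne_zero ?_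
  rw [two_mul_T, parity_natCast_zero, natT]
  rcases Nat.even_or_odd' n with ⟨k, rfl | rfl⟩
  · simp
  · have h1 : (2 * k + 1) % 2 = 1 := by omega
    have h2 : (3 * (2 * k + 1) + 1) / 2 = 3 * k + 2 := by omega
    rw [h1, if_neg one_ne_zero, h2]
    push_cast
    ring

theorem dvd_Q_sub_natQ (m n : ℕ) : (2 : ℤ_[2]) ^ m ∣ Q n - natQ m n := by
  induction m generalizing n with
  | zero => simp
  | succ m ih =>
    obtain ⟨z, hz⟩ := ih (natT n)
    rw [Q_eq, natQ, T_natCast, parity_natCast_zero]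
    exact ⟨z, by push_cast; linear_combination 2 * hz⟩

theorem dvd_Q_iterate_sub_natQ (m i n : ℕ) :
    (2 : ℤ_[2]) ^ m ∣ Q^[i] n - ((natQ m)^[i] n : ℕ) := by
  induction i with
  | zero => simp
  | succ i ih =>
    rw [Function.iterate_succ_apply', Function.iterate_succ_apply']
    simpa using ((dvd_Q_sub_iff _ _ _).2 ih).add (dvd_Q_sub_natQ m ((natQ m)^[i] n))

theorem oddCount_natCast (m n : ℕ) : oddCount m n = natOddCount m n := by
  induction m generalizing n with
  | zero => rfl
  | succ m ih => rw [oddCount_succ', T_natCast, parity_natCast_zero, ih, natOddCount]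

theorem oddCount_congr {m : ℕ} {x y : ℤ_[2]} (h : (2 : ℤ_[2]) ^ m ∣ x - y) :
    oddCount m x = oddCount m y := by
  obtain ⟨z, hz⟩ := h
  obtain rfl : x = y + 2 ^ m * z := by linear_combination hz
  exact oddCount_add m y z

/-- One digit beyond `m` decides whether the displacement is exactly `2 ^ m`, and the counts depend
only on `m` digits, so the criterion becomes a finite computation. -/
theorem evenReturn_natCast {m N n : ℕ} (h : (natQ (m + 1))^[N] n = n + 2 ^ m ∨
    (natQ (m + 1))^[N] n + 2 ^ m = n)
    (h' : Even (∑ i ∈ Finset.range N, natOddCount m ((natQ m)^[i] n))) :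
    EvenReturn m N (n : ℤ_[2]) := by
  constructor
  · obtain ⟨z, hz⟩ := dvd_Q_iterate_sub_natQ (m + 1) N n
    rcases h with h | h
    · rw [h] at hz
      push_cast at hz
      exact ⟨1 + 2 * z, fun h => not_two_dvd_one ((dvd_add_left (dvd_mul_right _ _)).1 h),
        by linear_combination hz⟩
    · have h2 : (((natQ (m + 1))^[N] n : ℕ) : ℤ_[2]) = n - 2 ^ m := by
        rw [eq_sub_iff_add_eq]; exact_mod_cast h
      rw [h2] at hz
      refine ⟨-1 + 2 * z, fun h => not_two_dvd_one ?_, by linear_combination hz⟩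
      exact (dvd_neg.1 ((dvd_add_left (dvd_mul_right _ _)).1 h))
  · convert h' using 3 with i
    rw [oddCount_congr (dvd_Q_iterate_sub_natQ m _ n), oddCount_natCast]

/-! ### The induced permutations of `ZMod (2 ^ n)` and their cycles. -/

theorem toZModPow_eq_iff {n : ℕ} {x y : ℤ_[2]} :
    PadicInt.toZModPow n x = PadicInt.toZModPow n y ↔ (2 : ℤ_[2]) ^ n ∣ x - y := by
  rw [← sub_eq_zero, ← map_sub, ← RingHom.mem_ker, PadicInt.ker_toZModPow,
    Ideal.mem_span_singleton]
  norm_num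

theorem toZModPow_val {n : ℕ} (z : ZMod (2 ^ n)) :
    PadicInt.toZModPow n (z.val : ℤ_[2]) = z := by
  rw [map_natCast, ZMod.natCast_zmod_val]

theorem toZModPow_Q (n : ℕ) (x : ℤ_[2]) :
    PadicInt.toZModPow n (Q x) = Qmod n (PadicInt.toZModPow n x) := by
  rw [Qmod, toZModPow_eq_iff, dvd_Q_sub_iff, ← toZModPow_eq_iff, toZModPow_val]

theorem toZModPow_Q_iterate (n i : ℕ) (x : ℤ_[2]) :
    PadicInt.toZModPow n (Q^[i] x) = (Qmod n)^[i] (PadicInt.toZModPow n x) :=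
  have h : Function.Semiconj (PadicInt.toZModPow n) Q (Qmod n) := toZModPow_Q n
  (h.iterate_right i).eq x

theorem Qmod_bijective (n : ℕ) : Function.Bijective (Qmod n) := by
  refine Finite.injective_iff_bijective.1 fun z w h => ?_
  rw [Qmod, Qmod, toZModPow_eq_iff, dvd_Q_sub_iff, ← toZModPow_eq_iff, toZModPow_val,
    toZModPow_val] at h
  exact h

theorem Qmod_eq_natQ (m : ℕ) (z : ZMod (2 ^ m)) : Qmod m z = (natQ m z.val : ZMod (2 ^ m)) := by
  have := toZModPow_eq_iff.2 (dvd_Q_sub_natQ m z.val)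
  rwa [map_natCast] at this

theorem getElem_of_map_eq_rotate {α : Type*} {f : α → α} {C : List α}
    (h : C.map f = C.rotate 1) {i : ℕ} (hi : i < C.length) :
    C[i] = f^[i] (C[0]'(by omega)) := by
  induction i with
  | zero => rfl
  | succ i ih =>
    rw [Function.iterate_succ_apply', ← ih (by omega)]
    have h1 : (C.map f)[i]'(by simp; omega) = (C.rotate 1)[i]'(by simp; omega) := by
      simp only [h]
    rw [List.getElem_map, List.getElem_rotate] at h1
    rw [h1]
    simp only [Nat.mod_eq_of_lt hi]

theorem isCycle_map_range {n N : ℕ} {z : ZMod (2 ^ n)} (hN : 0 < N)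
    (h : Function.minimalPeriod (Qmod n) z = N) :
    IsCycle n ((List.range N).map fun i => (Qmod n)^[i] z) := by
  refine ⟨by simp [hN.ne'], ?_, ?_⟩
  · have := Function.nodup_periodicOrbit (f := Qmod n) (x := z)
    rw [Function.periodicOrbit, h] at this
    exact Cycle.nodup_coe_iff.1 this
  · refine List.ext_getElem (by simp) fun i h1 h2 => ?_
    simp only [List.getElem_map, List.getElem_range, List.getElem_rotate, List.length_map,
      List.length_range]
    rw [← Function.iterate_succ_apply' (Qmod n), ← h, Function.iterate_mod_minimalPeriod_eq]

/-! ### Dense orbits and ever-doubling periods. -/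

/-- `C = (c₁, …)` is a cycle of `Q_m` of length `2 ^ k`, `k ≥ 1`, which satisfies the criterion for
an ever-doubling period. -/
structure IsDoublingCycle (m k : ℕ) (C : List (ZMod (2 ^ m))) : Prop where
  k_ne_zero : k ≠ 0
  k_le : k ≤ m
  isCycle : IsCycle m C
  length_eq : C.length = 2 ^ k
  evenReturn : ∀ c ∈ C.head?, EvenReturn m (2 ^ k) (c.val : ℤ_[2])

/-- The first element of a cycle, as a 2-adic integer. -/
noncomputable def base {m : ℕ} (C : List (ZMod (2 ^ m))) : ℤ_[2] := ((C.headD 0).val : ℤ_[2])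

namespace IsDoublingCycle

variable {m k : ℕ} {C : List (ZMod (2 ^ m))}

theorem length_pos (h : IsDoublingCycle m k C) : 0 < C.length := by
  rw [h.length_eq]; positivity

theorem base_eq (h : IsDoublingCycle m k C) : base C = ((C[0]'h.length_pos).val : ℤ_[2]) := by
  have := h.length_pos
  cases C with
  | nil => simp at this
  | cons a C => rfl

theorem evenReturn_base (h : IsDoublingCycle m k C) (d : ℕ) :
    EvenReturn (m + d) (2 ^ (k + d)) (base C) := by
  refine EvenReturn.add h.k_ne_zero ?_ d
  rw [h.base_eq]
  refine h.evenReturn _ ?_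
  simp [List.head?_eq_getElem?]

theorem toZModPow_iterate_base (h : IsDoublingCycle m k C) {i : ℕ} (hi : i < C.length) :
    PadicInt.toZModPow m (Q^[i] (base C)) = C[i] := by
  rw [toZModPow_Q_iterate, h.base_eq, toZModPow_val, getElem_of_map_eq_rotate h.isCycle.2.2 hi]

/-- The orbit of the base point is dense in the union of the residue classes of `C`. -/
theorem exists_iterate_base (h : IsDoublingCycle m k C) (d : ℕ) {x : ℤ_[2]}
    (hx : PadicInt.toZModPow m x ∈ C) :
    ∃ i, (2 : ℤ_[2]) ^ (m + d) ∣ x - Q^[i] (base C) := by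
  induction d with
  | zero =>
    obtain ⟨i, hi, hx⟩ := List.getElem_of_mem hx
    exact ⟨i, toZModPow_eq_iff.1 (hx.symm.trans (h.toZModPow_iterate_base hi).symm)⟩
  | succ d ih =>
    obtain ⟨i, w, hw⟩ := ih
    rcases two_dvd_or_two_dvd_sub_one w with ⟨v, rfl⟩ | ⟨v, hv⟩
    · exact ⟨i, v, by linear_combination hw⟩
    -- Digit `m + d` is wrong. Running `2 ^ (k + d)` steps before the `i` steps displaces the result
    -- by `2 ^ (m + d)` times an odd number, which corrects that digit.
    · obtain ⟨u, hu, hx⟩ := (h.evenReturn_base d).1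
      obtain ⟨s, hs⟩ := dvd_Q_iterate_add (m + d) i (base C) u
      have h3 : ¬ (2 : ℤ_[2]) ∣ 3 ^ (∑ j ∈ Finset.range i, oddCount (m + d) (Q^[j] (base C))) * u :=
        fun h => (prime_two.dvd_or_dvd h).elim (odd_three_pow _) hu
      obtain ⟨r, hr⟩ := (two_dvd_or_two_dvd_sub_one _).resolve_left h3
      refine ⟨i + 2 ^ (k + d), v - r - 2 * s, ?_⟩
      rw [Function.iterate_add_apply, hx]
      linear_combination hw - hs + 2 ^ (m + d) * (hv - hr)

/-- The return at level `d` shows that `2 ^ (k + d)` is a period. Half of it is not, since the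
return one level earlier is at distance too large; at `d = 0` distinctness of the elements of `C`
replaces this. -/
theorem minimalPeriod_eq (h : IsDoublingCycle m k C) (d : ℕ) :
    Function.minimalPeriod (Qmod (m + d)) (PadicInt.toZModPow (m + d) (base C)) =
      2 ^ (k + d) := by
  obtain ⟨j, rfl⟩ := Nat.exists_eq_succ_of_ne_zero h.k_ne_zero
  rw [show j.succ + d = (j + d) + 1 by omega]
  refine Function.minimalPeriod_eq_prime_pow ?_ ?_
  · rw [Function.IsPeriodicPt, Function.IsFixedPt, ← toZModPow_Q_iterate]
    cases d with
    | zero =>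
      have hlt : 2 ^ (j + 0) < C.length := by
        rw [h.length_eq]; exact Nat.pow_lt_pow_right one_lt_two (by omega)
      have h1 := h.toZModPow_iterate_base hlt
      have h0 := h.toZModPow_iterate_base h.length_pos
      intro he
      have := h1.symm.trans (he.trans h0)
      rw [h.isCycle.2.1.getElem_inj_iff] at this
      exact absurd this (by positivity)
    | succ d =>
      obtain ⟨u, hu, hx⟩ := (h.evenReturn_base d).1
      rw [show j.succ + d = j + (d + 1) by omega] at hx
      rw [toZModPow_eq_iff, hx]
      rintro ⟨w, hw⟩
      refine hu ⟨w, mul_left_cancel₀ (pow_ne_zero (m + d) prime_two.ne_zero) ?_⟩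
      linear_combination hw
  · rw [Function.IsPeriodicPt, Function.IsFixedPt, ← toZModPow_Q_iterate, toZModPow_eq_iff]
    obtain ⟨u, hu, hx⟩ := (h.evenReturn_base d).1
    rw [show j.succ + d = (j + d) + 1 by omega] at hx
    exact ⟨u, by linear_combination hx⟩

theorem everDoubling (h : IsDoublingCycle m k C) : EverDoubling m k C := by
  refine ⟨h.k_le, h.isCycle, h.length_eq, fun n hn => ?_⟩
  obtain ⟨d, rfl⟩ := Nat.exists_eq_add_of_le hn
  refine ⟨_, isCycle_map_range (Nat.two_pow_pos _) (h.minimalPeriod_eq d), ?_, fun c hc => ?_⟩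
  · simp; omega
  · obtain ⟨i, hi⟩ := h.exists_iterate_base d (x := c.val) (by rwa [toZModPow_val])
    refine List.mem_map.2 ⟨i % 2 ^ (k + d), List.mem_range.2 (Nat.mod_lt _ (by positivity)), ?_⟩
    rw [← h.minimalPeriod_eq d, Function.iterate_mod_minimalPeriod_eq, ← toZModPow_Q_iterate,
      ← toZModPow_eq_iff.2 hi, map_natCast]

theorem Q_mem_iff (h : IsDoublingCycle m k C) (x : ℤ_[2]) :
    PadicInt.toZModPow m (Q x) ∈ C ↔ PadicInt.toZModPow m x ∈ C := by
  rw [toZModPow_Q, ← List.mem_rotate (n := 1), ← h.isCycle.2.2,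
    List.mem_map_of_injective (Qmod_bijective m).1]

theorem Q_iterate_mem_iff (h : IsDoublingCycle m k C) (i : ℕ) (x : ℤ_[2]) :
    PadicInt.toZModPow m (Q^[i] x) ∈ C ↔ PadicInt.toZModPow m x ∈ C := by
  induction i with
  | zero => rfl
  | succ i ih => rw [Function.iterate_succ_apply', h.Q_mem_iff, ih]

/-- Every orbit over `C` visits every residue class over `C` infinitely often. -/
theorem exists_iterate (h : IsDoublingCycle m k C) (n N : ℕ) {x y : ℤ_[2]}
    (hx : PadicInt.toZModPow m x ∈ C) (hy : PadicInt.toZModPow m y ∈ C) :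
    ∃ i, N ≤ i ∧ (2 : ℤ_[2]) ^ n ∣ Q^[i] x - y := by
  obtain ⟨i, hi⟩ := h.exists_iterate_base n hx
  obtain ⟨j, hj⟩ := h.exists_iterate_base n hy
  have hper : ∀ t, (2 : ℤ_[2]) ^ (m + n) ∣ Q^[t * 2 ^ (k + n) + j] (base C) - y := by
    intro t
    rw [← toZModPow_eq_iff, toZModPow_eq_iff.2 hj, toZModPow_Q_iterate, toZModPow_Q_iterate,
      ← Function.iterate_mod_minimalPeriod_eq, h.minimalPeriod_eq, Nat.mul_add_mod',
      ← h.minimalPeriod_eq n, Function.iterate_mod_minimalPeriod_eq]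
  -- Taking `N + i` full periods keeps the subtraction of `i` from truncating and leaves at least
  -- `N` steps.
  have hle : N + i ≤ (N + i) * 2 ^ (k + n) := Nat.le_mul_of_pos_right _ (Nat.two_pow_pos _)
  refine ⟨(N + i) * 2 ^ (k + n) + j - i, by omega, (pow_dvd_pow _ (by omega : n ≤ m + n)).trans ?_⟩
  have h1 := (dvd_Q_iterate_sub_iff _ ((N + i) * 2 ^ (k + n) + j - i) _ _).2 hi
  rw [← Function.iterate_add_apply, Nat.sub_add_cancel (by omega)] at h1
  simpa using h1.add (hper (N + i))

end IsDoublingCycle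

/-! ### Residue classes as a basis and π-system; Haar measure and its invariance. -/

/-- The residue class of `z` modulo `2 ^ n`. -/
def residueClass (n : ℕ) (z : ZMod (2 ^ n)) : Set ℤ_[2] := PadicInt.toZModPow n ⁻¹' {z}

theorem mem_residueClass {n : ℕ} {z : ZMod (2 ^ n)} {x : ℤ_[2]} :
    x ∈ residueClass n z ↔ PadicInt.toZModPow n x = z := Iff.rfl

theorem mem_closedBall_iff {n : ℕ} {x y : ℤ_[2]} :
    x ∈ Metric.closedBall y ((2 : ℝ) ^ (-(n : ℤ))) ↔ (2 : ℤ_[2]) ^ n ∣ x - y := by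
  have := PadicInt.norm_le_pow_iff_mem_span_pow (p := 2) (x - y) n
  rw [Ideal.mem_span_singleton] at this
  rw [Metric.mem_closedBall, dist_eq_norm]
  exact_mod_cast this

theorem residueClass_toZModPow (n : ℕ) (x : ℤ_[2]) :
    residueClass n (PadicInt.toZModPow n x) = Metric.closedBall x ((2 : ℝ) ^ (-(n : ℤ))) := by
  ext y
  rw [mem_residueClass, mem_closedBall_iff, toZModPow_eq_iff]

theorem residueClass_eq_closedBall (n : ℕ) (z : ZMod (2 ^ n)) :
    residueClass n z = Metric.closedBall (z.val : ℤ_[2]) ((2 : ℝ) ^ (-(n : ℤ))) := by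
  rw [← residueClass_toZModPow, toZModPow_val]

theorem isClosed_residueClass (n : ℕ) (z : ZMod (2 ^ n)) : IsClosed (residueClass n z) := by
  rw [residueClass_eq_closedBall]; exact Metric.isClosed_closedBall

theorem isOpen_residueClass (n : ℕ) (z : ZMod (2 ^ n)) : IsOpen (residueClass n z) := by
  rw [residueClass_eq_closedBall]
  exact IsUltrametricDist.isOpen_closedBall _ (by positivity)

theorem measurableSet_residueClass (n : ℕ) (z : ZMod (2 ^ n)) :
    MeasurableSet (residueClass n z) := (isClosed_residueClass n z).measurableSet

theorem exists_closedBall_subset {x : ℤ_[2]} {U : Set ℤ_[2]} (hU : U ∈ nhds x) :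
    ∃ n : ℕ, Metric.closedBall x ((2 : ℝ) ^ (-(n : ℤ))) ⊆ U := by
  obtain ⟨ε, hε, h⟩ := Metric.nhds_basis_closedBall.mem_iff.1 hU
  obtain ⟨n, hn⟩ := exists_pow_lt_of_lt_one hε (by norm_num : (2⁻¹ : ℝ) < 1)
  refine ⟨n, (Metric.closedBall_subset_closedBall ?_).trans h⟩
  rw [zpow_neg, zpow_natCast, ← inv_pow]
  exact hn.le

/-- The collection of all residue classes. -/
def residueClasses : Set (Set ℤ_[2]) := {s | ∃ n z, s = residueClass n z}

theorem isTopologicalBasis_residueClasses :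
    TopologicalSpace.IsTopologicalBasis residueClasses := by
  refine TopologicalSpace.isTopologicalBasis_of_isOpen_of_nhds ?_ fun x U hx hU => ?_
  · rintro _ ⟨n, z, rfl⟩
    exact isOpen_residueClass n z
  · obtain ⟨n, hn⟩ := exists_closedBall_subset (hU.mem_nhds hx)
    refine ⟨_, ⟨n, PadicInt.toZModPow n x, rfl⟩, mem_residueClass.2 rfl, ?_⟩
    rwa [residueClass_toZModPow]

theorem residueClass_subset {n m : ℕ} (h : n ≤ m) (x : ℤ_[2]) :
    residueClass m (PadicInt.toZModPow m x) ⊆ residueClass n (PadicInt.toZModPow n x) := by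
  intro y hy
  rw [mem_residueClass, toZModPow_eq_iff] at hy ⊢
  exact (pow_dvd_pow _ h).trans hy

theorem isPiSystem_residueClasses : IsPiSystem residueClasses := by
  rintro _ ⟨n, z, rfl⟩ _ ⟨m, w, rfl⟩ ⟨x, hx, hy⟩
  rw [mem_residueClass] at hx hy
  subst hx hy
  rcases le_total n m with h | h
  · exact ⟨m, _, Set.inter_eq_right.2 (residueClass_subset h x)⟩
  · exact ⟨n, _, Set.inter_eq_left.2 (residueClass_subset h x)⟩

theorem borel_eq_generateFrom_residueClasses :
    (inferInstance : MeasurableSpace ℤ_[2]) = MeasurableSpace.generateFrom residueClasses :=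
  isTopologicalBasis_residueClasses.borel_eq_generateFrom

theorem univ_eq_residueClass : (Set.univ : Set ℤ_[2]) = residueClass 0 0 := by
  ext x
  simp [mem_residueClass, eq_iff_true_of_subsingleton]

theorem ext_of_residueClass {μ ν : Measure ℤ_[2]} [IsFiniteMeasure μ]
    (h : ∀ n z, μ (residueClass n z) = ν (residueClass n z)) : μ = ν := by
  refine ext_of_generate_finite _ borel_eq_generateFrom_residueClasses isPiSystem_residueClasses
    ?_ ?_
  · rintro _ ⟨n, z, rfl⟩
    exact h n z
  · rw [univ_eq_residueClass, h]

instance : IsProbabilityMeasure haar2 := ⟨haar2_univ⟩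

instance : haar2.IsAddHaarMeasure := by unfold haar2; infer_instance

theorem haar2_residueClass_eq (n : ℕ) (z w : ZMod (2 ^ n)) :
    haar2 (residueClass n z) = haar2 (residueClass n w) := by
  rw [← measure_preimage_add haar2 ((w.val : ℤ_[2]) - z.val) (residueClass n w)]
  congr 1
  ext x
  simp only [Set.mem_preimage, mem_residueClass, map_add, map_sub, toZModPow_val]
  constructor
  · rintro rfl; ring
  · intro h; linear_combination h

theorem measure_iUnion_residueClass (μ : Measure ℤ_[2]) {n : ℕ} (s : Finset (ZMod (2 ^ n))) :
    μ (PadicInt.toZModPow n ⁻¹' s) = ∑ z ∈ s, μ (residueClass n z) := by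
  rw [← measure_biUnion_finset]
  · congr 1
    ext x
    simp [mem_residueClass]
  · intro z _ w _ hzw
    refine Set.disjoint_left.2 fun x hx hy => hzw ?_
    exact (mem_residueClass.1 hx).symm.trans (mem_residueClass.1 hy)
  · exact fun z _ => measurableSet_residueClass n z

theorem haar2_residueClass (n : ℕ) (z : ZMod (2 ^ n)) :
    haar2 (residueClass n z) = (2⁻¹ : ℝ≥0∞) ^ n := by
  have h := measure_iUnion_residueClass haar2 (Finset.univ : Finset (ZMod (2 ^ n)))
  rw [Finset.coe_univ, Set.preimage_univ, haar2_univ,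
    Finset.sum_congr rfl fun w _ => haar2_residueClass_eq n w z, Finset.sum_const,
    Finset.card_univ, ZMod.card, nsmul_eq_mul] at h
  rw [← ENNReal.inv_pow]
  refine ENNReal.eq_inv_of_mul_eq_one_left ?_
  rw [h, mul_comm]
  push_cast
  rfl

theorem Q_preimage_residueClass (n : ℕ) (z : ZMod (2 ^ n)) :
    Q ⁻¹' residueClass n (Qmod n z) = residueClass n z := by
  ext x
  rw [Set.mem_preimage, mem_residueClass, toZModPow_Q, (Qmod_bijective n).1.eq_iff,
    mem_residueClass]

theorem continuous_Q : Continuous Q := by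
  refine isTopologicalBasis_residueClasses.continuous_iff.2 ?_
  rintro _ ⟨n, z, rfl⟩
  obtain ⟨w, rfl⟩ := (Qmod_bijective n).2 z
  rw [Q_preimage_residueClass]
  exact isOpen_residueClass n w

/-- At each level `Q` permutes the residue classes, which all have the same measure. -/
theorem measurePreserving_Q : MeasurePreserving Q haar2 haar2 := by
  refine ⟨continuous_Q.measurable, ?_⟩
  have : IsFiniteMeasure (haar2.map Q) := inferInstance
  refine ext_of_residueClass fun n z => ?_
  obtain ⟨w, rfl⟩ := (Qmod_bijective n).2 z
  rw [Measure.map_apply continuous_Q.measurable (measurableSet_residueClass n _),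
    Q_preimage_residueClass, haar2_residueClass, haar2_residueClass]

/-! ### ω-limit sets and ergodicity over a doubling cycle. -/

/-- The union of the residue classes in a list. -/
def classUnion (m : ℕ) (C : List (ZMod (2 ^ m))) : Set ℤ_[2] := {x | PadicInt.toZModPow m x ∈ C}

theorem ballUnion_eq_classUnion (m : ℕ) (C : List (ZMod (2 ^ m))) :
    ballUnion m C = classUnion m C := by
  ext x
  simp only [ballUnion, Set.mem_iUnion, ← residueClass_eq_closedBall, mem_residueClass, classUnion,
    Set.mem_ofPred_eq]
  simp

theorem isClosed_classUnion (m : ℕ) (C : List (ZMod (2 ^ m))) : IsClosed (classUnion m C) := by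
  have : classUnion m C = ⋃ z ∈ {z | z ∈ C}, residueClass m z := by
    ext x; simp [classUnion, mem_residueClass]
  rw [this]
  exact (Set.toFinite _).isClosed_biUnion fun z _ => isClosed_residueClass m z

theorem haar2_classUnion {m : ℕ} {C : List (ZMod (2 ^ m))} (hC : C.Nodup) :
    haar2 (classUnion m C) = C.length * (2⁻¹ : ℝ≥0∞) ^ m := by
  have h := measure_iUnion_residueClass haar2 C.toFinset
  rw [Finset.sum_congr rfl fun w _ => haar2_residueClass m w, Finset.sum_const,
    List.toFinset_card_of_nodup hC, nsmul_eq_mul] at h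
  rw [← h]
  congr 1
  ext x
  simp [classUnion]

theorem measure_inter_iterate (μ : Measure ℤ_[2]) (hμ : MeasurePreserving Q μ μ) (n i : ℕ)
    (x : ℤ_[2]) :
    μ (residueClass n (PadicInt.toZModPow n (Q^[i] x))) =
      μ (residueClass n (PadicInt.toZModPow n x)) := by
  induction i with
  | zero => rfl
  | succ i ih =>
    rw [← ih, Function.iterate_succ_apply', toZModPow_Q, ← hμ.measure_preimage
      (measurableSet_residueClass _ _).nullMeasurableSet, Q_preimage_residueClass]

namespace IsDoublingCycle

variable {m k : ℕ} {C : List (ZMod (2 ^ m))}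

theorem preimage_classUnion (h : IsDoublingCycle m k C) :
    Q ⁻¹' classUnion m C = classUnion m C := Set.ext h.Q_mem_iff

theorem omegaQ_singleton (h : IsDoublingCycle m k C) {x : ℤ_[2]} (hx : x ∈ classUnion m C) :
    classUnion m C ⊆ omegaQ {x} := by
  intro y hy
  rw [omegaQ, mem_omegaLimit_singleton_iff_mapClusterPt, mapClusterPt_iff_frequently]
  intro U hU
  obtain ⟨n, hn⟩ := exists_closedBall_subset hU
  refine frequently_atTop.2 fun N => ?_
  obtain ⟨i, hi, hd⟩ := h.exists_iterate n N hx hy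
  exact ⟨i, hi, hn (mem_closedBall_iff.2 hd)⟩

theorem omegaQ_subset (h : IsDoublingCycle m k C) {S : Set ℤ_[2]} (hS : S ⊆ classUnion m C) :
    omegaQ S ⊆ classUnion m C := by
  refine (Set.iInter₂_subset Set.univ univ_mem).trans ?_
  refine closure_minimal ?_ (isClosed_classUnion m C)
  rintro _ ⟨i, -, x, hx, rfl⟩
  exact (h.Q_iterate_mem_iff i x).2 (hS hx)

theorem omegaQ_eq (h : IsDoublingCycle m k C) {S : Set ℤ_[2]} (hS : S ⊆ classUnion m C)
    (hne : S.Nonempty) : omegaQ S = classUnion m C := by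
  obtain ⟨x, hx⟩ := hne
  refine (h.omegaQ_subset hS).antisymm ((h.omegaQ_singleton (hS hx)).trans ?_)
  exact omegaLimit_mono_right _ _ (Set.singleton_subset_iff.2 hx)

theorem omegaCycle_eq (h : IsDoublingCycle m k C) : omegaCycle m C = classUnion m C := by
  refine h.omegaQ_eq ?_ ⟨_, C[0]'h.length_pos, List.getElem_mem _, rfl⟩
  rintro _ ⟨c, hc, rfl⟩
  rwa [classUnion, Set.mem_ofPred_eq, toZModPow_val]

theorem measure_residueClass_eq (h : IsDoublingCycle m k C) {μ : Measure ℤ_[2]}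
    (hμ : MeasurePreserving Q μ μ) (n : ℕ) {x y : ℤ_[2]} (hx : x ∈ classUnion m C)
    (hy : y ∈ classUnion m C) :
    μ (residueClass n (PadicInt.toZModPow n x)) = μ (residueClass n (PadicInt.toZModPow n y)) := by
  obtain ⟨i, -, hi⟩ := h.exists_iterate n 0 hx hy
  rw [← toZModPow_eq_iff.2 hi, measure_inter_iterate μ hμ]

/-- Any two finite `Q`-invariant measures on the union of the residue classes of `C` are
proportional. -/
theorem measure_proportional (h : IsDoublingCycle m k C) {μ ν : Measure ℤ_[2]}
    [IsFiniteMeasure μ] [IsFiniteMeasure ν]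
    (hμ : MeasurePreserving Q μ μ) (hν : MeasurePreserving Q ν ν)
    (hμ0 : μ (classUnion m C)ᶜ = 0) (hν0 : ν (classUnion m C)ᶜ = 0) :
    ν Set.univ • μ = μ Set.univ • ν := by
  have : IsFiniteMeasure (ν Set.univ • μ) := Measure.smul_finite μ (measure_ne_top _ _)
  refine ext_of_residueClass fun n z => ?_
  simp only [Measure.smul_apply, smul_eq_mul]
  obtain ⟨x, rfl⟩ : ∃ x, PadicInt.toZModPow n x = z := ⟨_, toZModPow_val z⟩
  by_cases hz : ∃ y ∈ classUnion m C, y ∈ residueClass n (PadicInt.toZModPow n x)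
  · obtain ⟨y, hy, hyz⟩ := hz
    rw [mem_residueClass] at hyz
    rw [← hyz]
    classical
    -- By transitivity all classes over `C` have equal mass, so the total is that mass times a
    -- number of classes independent of `ρ`.
    have key : ∀ {ρ : Measure ℤ_[2]}, MeasurePreserving Q ρ ρ → ρ (classUnion m C)ᶜ = 0 →
        ρ Set.univ = ((Finset.univ.filter fun w : ZMod (2 ^ n) =>
          ∃ y ∈ classUnion m C, PadicInt.toZModPow n y = w).card : ℝ≥0∞) *
          ρ (residueClass n (PadicInt.toZModPow n y)) := by
      intro ρ hρ hρ0
      have h1 := measure_iUnion_residueClass ρ (Finset.univ : Finset (ZMod (2 ^ n)))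
      rw [Finset.coe_univ, Set.preimage_univ] at h1
      rw [h1, ← nsmul_eq_mul, ← Finset.sum_const]
      rw [Finset.sum_filter]
      refine Finset.sum_congr rfl fun w _ => ?_
      split_ifs with hw
      · obtain ⟨y', hy', rfl⟩ := hw
        exact h.measure_residueClass_eq hρ n hy' hy
      · refine measure_mono_null (fun v hv hvC => hw ⟨v, hvC, hv⟩) hρ0
    rw [key hμ hμ0, key hν hν0]
    ring
  · have hsub : residueClass n (PadicInt.toZModPow n x) ⊆ (classUnion m C)ᶜ :=
      fun v hv hvC => hz ⟨v, hvC, hv⟩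
    rw [measure_mono_null hsub hμ0, measure_mono_null hsub hν0, mul_zero, mul_zero]

/-- For an invariant `A`, Haar measure restricted to the class union and to its intersection with
`A` are proportional. The second vanishes on the complement of `A`, so either it is zero or the
first vanishes there too. -/
theorem ergodic (h : IsDoublingCycle m k C) : Ergodic Q (haar2.restrict (classUnion m C)) := by
  have hB : MeasurableSet (classUnion m C) := (isClosed_classUnion m C).measurableSet
  have hres : ∀ A, MeasurableSet A → Q ⁻¹' A = A →
      MeasurePreserving Q (haar2.restrict A) (haar2.restrict A) := by
    intro A hA hQ
    have := measurePreserving_Q.restrict_preimage hA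
    rwa [hQ] at this
  refine ⟨hres _ hB h.preimage_classUnion, ⟨fun A hA hQ => ?_⟩⟩
  have hAB : MeasurableSet (A ∩ classUnion m C) := hA.inter hB
  have hp := h.measure_proportional (hres _ hB h.preimage_classUnion)
    (hres _ hAB (by rw [Set.preimage_inter, hQ, h.preimage_classUnion]))
    (by rw [Measure.restrict_apply hB.compl]; simp)
    (by rw [Measure.restrict_apply hB.compl]; convert measure_empty (μ := haar2); ext; simp; tauto)
  have hp2 := congrArg (fun ρ : Measure ℤ_[2] => ρ Aᶜ) hp
  simp only [Measure.smul_apply, smul_eq_mul] at hp2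
  rw [Measure.restrict_apply hA.compl (s := A ∩ classUnion m C),
    show Aᶜ ∩ (A ∩ classUnion m C) = ∅ by ext; simp; tauto, measure_empty, mul_zero,
    mul_eq_zero, Measure.restrict_apply_univ] at hp2
  rw [Filter.eventuallyConst_set']
  rcases hp2 with h0 | h0
  · left
    rw [ae_eq_empty, Measure.restrict_apply hA, h0]
  · right
    rw [ae_eq_univ, h0]

theorem isErgodicSet (h : IsDoublingCycle m k C) : IsErgodicSet (classUnion m C) := by
  refine ⟨isClosed_classUnion m C, h.preimage_classUnion, ?_, h.ergodic⟩
  rw [haar2_classUnion h.isCycle.2.1]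
  refine ENNReal.mul_pos ?_ (by simp)
  exact_mod_cast h.length_pos.ne'

end IsDoublingCycle

/-! ### Comparing and bounding ergodic sets. -/

theorem IsErgodicSet.ae_subset {A U : Set ℤ_[2]} (hA : IsErgodicSet A) (hU : MeasurableSet U)
    (hQ : Q ⁻¹' U = U) (h0 : haar2 (A ∩ U) ≠ 0) : haar2 (A \ U) = 0 := by
  rcases hA.2.2.2.ae_empty_or_univ hU hQ with h | h
  · rw [ae_eq_empty, Measure.restrict_apply hU, Set.inter_comm] at h
    exact absurd h h0
  · rwa [ae_eq_univ, Measure.restrict_apply hU.compl, Set.inter_comm, ← Set.sdiff_eq] at h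

theorem IsErgodicSet.ae_eq {A B : Set ℤ_[2]} (hA : IsErgodicSet A) (hB : IsErgodicSet B)
    (h0 : haar2 (A ∩ B) ≠ 0) : A =ᵐ[haar2] B :=
  (ae_le_set.2 (hA.ae_subset hB.1.measurableSet hB.2.1 h0)).antisymm
    (ae_le_set.2 (hB.ae_subset hA.1.measurableSet hA.2.1 (by rwa [Set.inter_comm])))

/-- An ergodic set that charges a residue class of period at most `N` modulo `2 ^ n` has measure at
most `N / 2 ^ n`. -/
theorem IsErgodicSet.measure_le {A : Set ℤ_[2]} (hA : IsErgodicSet A) {n N : ℕ} (hN : 0 < N)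
    {z : ZMod (2 ^ n)} (hz : (Qmod n)^[N] z = z) (h0 : haar2 (A ∩ residueClass n z) ≠ 0) :
    haar2 A ≤ N * (2⁻¹ : ℝ≥0∞) ^ n := by
  set s : Finset (ZMod (2 ^ n)) := (Finset.range N).image fun i => (Qmod n)^[i] z
  have hs : ∀ w, Qmod n w ∈ s ↔ w ∈ s := by
    have hmap : ∀ w ∈ s, Qmod n w ∈ s := by
      intro w hw
      obtain ⟨i, hi, rfl⟩ := Finset.mem_image.1 hw
      rw [← Function.iterate_succ_apply' (Qmod n)]
      rcases (Nat.succ_le_of_lt (Finset.mem_range.1 hi)).lt_or_eq with h | h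
      · exact Finset.mem_image_of_mem _ (Finset.mem_range.2 h)
      · rw [h, hz]; exact Finset.mem_image.2 ⟨0, Finset.mem_range.2 hN, rfl⟩
    intro w
    refine ⟨fun hw => ?_, hmap w⟩
    have := Finset.surj_on_of_inj_on_of_card_le (s := s) (t := s) (fun a _ => Qmod n a)
      hmap (fun a b _ _ h => (Qmod_bijective n).1 h) le_rfl _ hw
    obtain ⟨a, ha, h⟩ := this
    rwa [(Qmod_bijective n).1 h]
  have hzs : z ∈ s := Finset.mem_image.2 ⟨0, Finset.mem_range.2 hN, rfl⟩
  set U : Set ℤ_[2] := PadicInt.toZModPow n ⁻¹' s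
  have hUm : MeasurableSet U := by
    have : U = ⋃ w ∈ s, residueClass n w := by ext x; simp [U, mem_residueClass]
    rw [this]
    exact Finset.measurableSet_biUnion _ fun w _ => measurableSet_residueClass n w
  have hUQ : Q ⁻¹' U = U := by
    ext x
    simp only [U, Set.mem_preimage, Finset.mem_coe, toZModPow_Q, hs]
  have hsub := hA.ae_subset hUm hUQ fun h => h0 <| measure_mono_null
    (Set.inter_subset_inter_right A fun x hx => by
      rw [mem_residueClass] at hx
      simpa [U, hx] using hzs) h
  calc haar2 A ≤ haar2 (U ∪ A \ U) :=
        measure_mono (by rw [Set.union_sdiff_self]; exact Set.subset_union_right)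
    _ ≤ haar2 U + haar2 (A \ U) := measure_union_le _ _
    _ = s.card * (2⁻¹ : ℝ≥0∞) ^ n := by
      rw [hsub, add_zero, measure_iUnion_residueClass,
        Finset.sum_congr rfl fun w _ => haar2_residueClass n w, Finset.sum_const, nsmul_eq_mul]
    _ ≤ N * (2⁻¹ : ℝ≥0∞) ^ n := by
      gcongr
      exact Finset.card_image_le.trans (by simp)

/-! ### Verification of the table and its completeness. -/

theorem IsDoublingCycle.of_natQ {m k : ℕ} {C : List (ZMod (2 ^ m))} (hk : k ≠ 0) (hkm : k ≤ m)
    (hC : C ≠ []) (hnd : C.Nodup)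
    (hmap : C.map (fun z => (natQ m z.val : ZMod (2 ^ m))) = C.rotate 1) (hl : C.length = 2 ^ k)
    (hret : ∀ c ∈ C.head?, ((natQ (m + 1))^[2 ^ k] c.val = c.val + 2 ^ m ∨
      (natQ (m + 1))^[2 ^ k] c.val + 2 ^ m = c.val) ∧
      Even (∑ i ∈ Finset.range (2 ^ k), natOddCount m ((natQ m)^[i] c.val))) :
    IsDoublingCycle m k C := by
  refine ⟨hk, hkm, ⟨hC, hnd, ?_⟩, hl, fun c hc => evenReturn_natCast (hret c hc).1 (hret c hc).2⟩
  rw [← hmap]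
  exact List.map_congr_left fun z _ => Qmod_eq_natQ m z

theorem isDoublingCycle_table {r : Row} (hr : r ∈ table) : IsDoublingCycle r.m r.k r.C := by
  simp only [table, List.mem_cons, List.not_mem_nil, or_false] at hr
  rcases hr with rfl | rfl | rfl | rfl | rfl
  all_goals
    refine IsDoublingCycle.of_natQ (by decide) (by decide) (by decide) (by decide +kernel)
      (by decide +kernel) (by decide) ?_
    simp only [List.head?_cons, Option.mem_some_iff, forall_eq']
    decide +kernel

theorem length_table {r : Row} (hr : r ∈ table) :
    (r.C.length : ℝ≥0∞) * 2⁻¹ ^ r.m = 2⁻¹ ^ r.e := by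
  have h : r.C.length = 2 ^ r.k ∧ r.m = r.k + r.e := by
    simp only [table, List.mem_cons, List.not_mem_nil, or_false] at hr
    rcases hr with rfl | rfl | rfl | rfl | rfl <;> decide
  rw [h.1, h.2, pow_add, ← mul_assoc, Nat.cast_pow, Nat.cast_ofNat, ← mul_pow,
    ENNReal.mul_inv_cancel two_ne_zero ENNReal.ofNat_ne_top, one_pow, one_mul]

/-- Modulo `2 ^ 10`, the odd cycles outside the table have length at most `8`. -/
theorem natQ_iterate_eight : ∀ n < 2 ^ 10, n % 2 = 1 →
    n % 2 ^ 5 ∈ [5, 17] ∨ n % 2 ^ 6 ∈ [9, 29, 25, 13] ∨ n % 2 ^ 6 ∈ [41, 61, 57, 45] ∨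
    n % 2 ^ 8 ∈ [27, 251, 219, 59] ∨ n % 2 ^ 8 ∈ [91, 187, 155, 123] ∨
    (natQ 10)^[8] n = n := by
  decide +kernel

theorem mem_of_mod_mem {m : ℕ} {l : List ℕ} {n : ℕ} (h : n % 2 ^ m ∈ l) :
    (n : ZMod (2 ^ m)) ∈ l.map (fun a : ℕ => (a : ZMod (2 ^ m))) :=
  List.mem_map.2 ⟨_, h, ZMod.natCast_mod n _⟩

theorem table_or_iterate_eight (n : ℕ) (hn : n < 2 ^ 10) (hodd : n % 2 = 1) :
    (∃ r ∈ table, (n : ZMod (2 ^ r.m)) ∈ r.C) ∨ (natQ 10)^[8] n = n := by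
  rcases natQ_iterate_eight n hn hodd with h | h | h | h | h | h
  · exact Or.inl ⟨_, .head _, mem_of_mod_mem h⟩
  · exact Or.inl ⟨_, .tail _ (.head _), mem_of_mod_mem h⟩
  · exact Or.inl ⟨_, .tail _ (.tail _ (.head _)), mem_of_mod_mem h⟩
  · exact Or.inl ⟨_, .tail _ (.tail _ (.tail _ (.head _))), mem_of_mod_mem h⟩
  · exact Or.inl ⟨_, .tail _ (.tail _ (.tail _ (.tail _ (.head _)))), mem_of_mod_mem h⟩
  · exact Or.inr h

theorem m_le_ten {r : Row} (hr : r ∈ table) : r.m ≤ 10 := by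
  simp only [table, List.mem_cons, List.not_mem_nil, or_false] at hr
  rcases hr with rfl | rfl | rfl | rfl | rfl <;> decide

theorem Qmod_iterate_natCast (n i a : ℕ) :
    (Qmod n)^[i] (a : ZMod (2 ^ n)) = ((natQ n)^[i] a : ℕ) := by
  have := toZModPow_eq_iff.2 (dvd_Q_iterate_sub_natQ n i a)
  rwa [toZModPow_Q_iterate, map_natCast, map_natCast] at this

theorem exists_residueClass_ne_zero {A : Set ℤ_[2]} (n : ℕ) (hA : haar2 A ≠ 0) :
    ∃ z : ZMod (2 ^ n), haar2 (A ∩ residueClass n z) ≠ 0 := by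
  by_contra! h
  refine hA (measure_mono_null (fun x hx => ?_) (measure_iUnion_null h))
  exact Set.mem_iUnion.2 ⟨PadicInt.toZModPow n x, hx, rfl⟩

theorem IsErgodicSet.exists_table {A : Set ℤ_[2]} (hA : IsErgodicSet A)
    (hodd : ∀ x ∈ A, ¬ (2 : ℤ_[2]) ∣ x) (hle : (2⁻¹ : ℝ≥0∞) ^ 6 ≤ haar2 A) :
    ∃ r ∈ table, A =ᵐ[haar2] classUnion r.m r.C := by
  obtain ⟨z, hz⟩ := exists_residueClass_ne_zero 10 hA.2.2.1.ne'
  obtain ⟨x, hxA, hxz⟩ := nonempty_of_measure_ne_zero hz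
  have hzx : ∀ y ∈ residueClass 10 z, (2 : ℤ_[2]) ^ 10 ∣ y - z.val := fun y hy => by
    rw [← toZModPow_eq_iff, toZModPow_val]; exact hy
  have hzodd : z.val % 2 = 1 := by
    rw [← Nat.mod_two_ne_zero, Ne, ← two_dvd_natCast_iff]
    intro h
    have h2 := (dvd_pow_self (2 : ℤ_[2]) (by norm_num : 10 ≠ 0)).trans (hzx x hxz)
    exact hodd x hxA ((dvd_sub_left h).1 h2)
  rcases table_or_iterate_eight z.val (ZMod.val_lt z) hzodd with ⟨r, hr, h⟩ | h
  · refine ⟨r, hr, hA.ae_eq (isDoublingCycle_table hr).isErgodicSet fun h0 => hz ?_⟩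
    refine measure_mono_null (Set.inter_subset_inter_right A fun y hy => ?_) h0
    rw [classUnion, Set.mem_ofPred_eq,
      toZModPow_eq_iff.2 ((pow_dvd_pow _ (m_le_ten hr)).trans (hzx y hy)), map_natCast]
    exact h
  · exfalso
    have h8 : (Qmod 10)^[8] z = z := by
      have := Qmod_iterate_natCast 10 8 z.val
      rwa [h, ZMod.natCast_zmod_val] at this
    -- The bound is `8 / 2 ^ 10 = 2 ^ (-7)`.
    refine absurd (hle.trans (hA.measure_le (by norm_num) h8 hz)) (not_le.2 ?_)
    rw [← ENNReal.toReal_lt_toReal (by finiteness) (by finiteness)]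
    norm_num

end CollatzErgodic

theorem mainTheorem7 :
    (∀ r ∈ CollatzErgodic.table,
      CollatzErgodic.EverDoubling r.m r.k r.C ∧
      CollatzErgodic.IsErgodicSet (CollatzErgodic.omegaCycle r.m r.C) ∧
      CollatzErgodic.haar2 (CollatzErgodic.omegaCycle r.m r.C) = (2⁻¹ : ENNReal) ^ r.e ∧
      CollatzErgodic.omegaCycle r.m r.C = CollatzErgodic.ballUnion r.m r.C ∧
      ∀ x ∈ CollatzErgodic.ballUnion r.m r.C,
        CollatzErgodic.omegaQ {x} = CollatzErgodic.omegaCycle r.m r.C) ∧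
    (∀ A : Set ℤ_[2], CollatzErgodic.IsErgodicSet A → (∀ x ∈ A, ¬ (2 : ℤ_[2]) ∣ x) →
      (2⁻¹ : ENNReal) ^ 6 ≤ CollatzErgodic.haar2 A →
      ∃ r ∈ CollatzErgodic.table,
        A =ᵐ[CollatzErgodic.haar2] CollatzErgodic.omegaCycle r.m r.C) := by
  refine ⟨fun r hr => ?_, fun A hA hodd hle => ?_⟩
  · have h := CollatzErgodic.isDoublingCycle_table hr
    rw [h.omegaCycle_eq, CollatzErgodic.ballUnion_eq_classUnion]
    exact ⟨h.everDoubling, h.isErgodicSet,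
      (CollatzErgodic.haar2_classUnion h.isCycle.2.1).trans (CollatzErgodic.length_table hr), rfl,
      fun x hx => h.omegaQ_eq (Set.singleton_subset_iff.2 hx) (Set.singleton_nonempty x)⟩
  · obtain ⟨r, hr, h⟩ := hA.exists_table hodd hle
    refine ⟨r, hr, ?_⟩
    rwa [(CollatzErgodic.isDoublingCycle_table hr).omegaCycle_eq]
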